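/- Let $\Lambda\subset\mathbb C$ be a lattice of rank 2, let $U,V:\mathbb C\to\mathbb C$ be $\Lambda$-periodic bounded measurable potentials (for instance smooth ones), and let $$L=\begin{pmatrix}0&\partial\\-\bar\partial&0\end{pmatrix}+\begin{pmatrix}U&0\\0&V\end{pmatrix},\qquad \partial=\tfrac12(\partial_x-i\partial_y),\quad \bar\partial=\tfrac12(\partial_x+i\partial_y),\quad z=x+iy.$$ A Floquet function of $L$ with eigenvalue $E$ and quasi-impulses $k=(k_1,k_2)\in\mathbb C^2$ is a nonzero, locally square-integrable function $\psi=(\psi_1,\psi_2)$ on $\mathbb C$ with $L\psi=E\psi$ (in the sense of distributions) and $\psi(z+\gamma)=\exp\bigl(2\pi i(\operatorname{Re}\gamma\, k_1+\operatorname{Im}\gamma\, k_2)\bigr)\psi(z)$ for all $\gamma\in\Lambda$. Let $\widehat\Gamma\subset\mathbb C^2$ be the set of quasi-impulses of the Floquet functions with eigenvalue $E=0$. It is invariant under translations by the dual lattice $\Lambda^*$, i.e. by the vectors $(\operatorname{Re}\gamma^*,\operatorname{Im}\gamma^*)$ with $\gamma^*\in\mathbb C$ and $\operatorname{Re}\gamma\operatorname{Re}\gamma^*+\operatorname{Im}\gamma\operatorname{Im}\gamma^*\in\mathbb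 Z$ for all $\gamma\in\Lambda$, and $\Gamma=\widehat\Gamma/\Lambda^*\subset\mathbb C^2/\Lambda^*$ is the Floquet spectrum of $L$ at zero energy. 1. If $U=\bar V$, then the anti-involution $(k_1,k_2)\mapsto(-\bar k_1,-\bar k_2)$ preserves the Floquet spectrum: it maps $\widehat\Gamma$ onto $\widehat\Gamma$, and the map it induces on $\mathbb C^2/\Lambda^*$ maps $\Gamma$ onto $\Gamma$. 2. If $U=\bar U$ and $V=\bar V$, then the same holds for the anti-involution $(k_1,k_2)\mapsto(\bar k_1,\bar k_2)$. -/

import Mathlib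

open MeasureTheory Complex
open scoped ComplexConjugate ContDiff ENNReal

noncomputable section

namespace DiracFloquet

/-- The Wirtinger derivative `∂ = (∂ₓ - i ∂_y) / 2`, where `z = x + i y`. -/
def dz (η : ℂ → ℂ) (z : ℂ) : ℂ := (fderiv ℝ η z 1 - I * fderiv ℝ η z I) / 2

/-- The Wirtinger derivative `∂̄ = (∂ₓ + i ∂_y) / 2`, where `z = x + i y`. -/
def dzbar (η : ℂ → ℂ) (z : ℂ) : ℂ := (fderiv ℝ η z 1 + I * fderiv ℝ η z I) / 2

/-- `g = ∂ f` in the sense of distributions on `ℂ`. -/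
def IsWeakDz (f g : ℂ → ℂ) : Prop :=
  LocallyIntegrable f ∧ LocallyIntegrable g ∧
    ∀ η : ℂ → ℂ, ContDiff ℝ ∞ η → HasCompactSupport η →
      ∫ z, f z * dz η z = -∫ z, g z * η z

/-- `g = ∂̄ f` in the sense of distributions on `ℂ`. -/
def IsWeakDzbar (f g : ℂ → ℂ) : Prop :=
  LocallyIntegrable f ∧ LocallyIntegrable g ∧
    ∀ η : ℂ → ℂ, ContDiff ℝ ∞ η → HasCompactSupport η →
      ∫ z, f z * dzbar η z = -∫ z, g z * η z

/-- A function on `ℂ` that is square integrable on compact sets. -/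
def IsLocallyL2 (f : ℂ → ℂ) : Prop :=
  ∀ K : Set ℂ, IsCompact K → MemLp f 2 (volume.restrict K)

/-- `f` is periodic with respect to `Λ` (as an almost everywhere defined function). -/
def IsPeriodic (Λ : Submodule ℤ ℂ) (f : ℂ → ℂ) : Prop :=
  ∀ γ ∈ Λ, ∀ᵐ z, f (z + γ) = f z

/-- A `Λ`-periodic potential: an essentially bounded measurable function, periodic under `Λ`. -/
def IsPeriodicPotential (Λ : Submodule ℤ ℂ) (U : ℂ → ℂ) : Prop :=
  MemLp U ∞ volume ∧ IsPeriodic Λ U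

/-- The equation `L ψ = E ψ` for `ψ = (ψ₁, ψ₂)` and the operator
`L = ((0, ∂), (-∂̄, 0)) + ((U, 0), (0, V))`, with derivatives in the sense of distributions. -/
def SolvesDirac (U V : ℂ → ℂ) (E : ℂ) (ψ₁ ψ₂ : ℂ → ℂ) : Prop :=
  ∃ d₁ d₂ : ℂ → ℂ, IsWeakDzbar ψ₁ d₁ ∧ IsWeakDz ψ₂ d₂ ∧
    (∀ᵐ z, U z * ψ₁ z + d₂ z = E * ψ₁ z) ∧
    (∀ᵐ z, -d₁ z + V z * ψ₂ z = E * ψ₂ z)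

/-- The multiplier `exp (2 π i (Re γ · k₁ + Im γ · k₂))` with quasi-impulses `k = (k₁, k₂)`. -/
def multiplier (k : ℂ × ℂ) (γ : ℂ) : ℂ :=
  Complex.exp (2 * Real.pi * I * (γ.re * k.1 + γ.im * k.2))

/-- `ψ = (ψ₁, ψ₂)` is a (nonzero) Floquet function of `L` with eigenvalue `E` and
quasi-impulses `k = (k₁, k₂)`. -/
structure IsFloquetFunction (Λ : Submodule ℤ ℂ) (U V : ℂ → ℂ) (E : ℂ) (k : ℂ × ℂ)
    (ψ₁ ψ₂ : ℂ → ℂ) : Prop where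
  locallyL2_fst : IsLocallyL2 ψ₁
  locallyL2_snd : IsLocallyL2 ψ₂
  ne_zero : ¬ ∀ᵐ z, ψ₁ z = 0 ∧ ψ₂ z = 0
  solves : SolvesDirac U V E ψ₁ ψ₂
  quasiperiodic : ∀ γ ∈ Λ, ∀ᵐ z,
    ψ₁ (z + γ) = multiplier k γ * ψ₁ z ∧ ψ₂ (z + γ) = multiplier k γ * ψ₂ z

/-- The set `Γ̂ ⊆ ℂ²` of quasi-impulses of the Floquet functions of `L` with eigenvalue `0`. -/
def quasiImpulses (Λ : Submodule ℤ ℂ) (U V : ℂ → ℂ) : Set (ℂ × ℂ) :=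
  {k | ∃ ψ₁ ψ₂ : ℂ → ℂ, IsFloquetFunction Λ U V 0 k ψ₁ ψ₂}

/-- The dual lattice `Λ*`, as the group of vectors `(Re γ*, Im γ*)` in `ℂ²`, where `γ*` runs over
the complex numbers with `Re γ · Re γ* + Im γ · Im γ* ∈ ℤ` for all `γ ∈ Λ`. -/
def dualLattice (Λ : Submodule ℤ ℂ) : AddSubgroup (ℂ × ℂ) where
  carrier := {k | ∃ δ : ℂ, (∀ γ ∈ Λ, ∃ n : ℤ, γ.re * δ.re + γ.im * δ.im = n) ∧
    k = ((δ.re : ℂ), (δ.im : ℂ))}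
  zero_mem' := ⟨0, fun _ _ => ⟨0, by simp⟩, by ext <;> simp⟩
  add_mem' := by
    rintro _ _ ⟨a, ha, rfl⟩ ⟨b, hb, rfl⟩
    refine ⟨a + b, fun γ hγ => ?_, by ext <;> simp⟩
    obtain ⟨m, hm⟩ := ha γ hγ
    obtain ⟨n, hn⟩ := hb γ hγ
    refine ⟨m + n, ?_⟩
    push_cast
    rw [← hm, ← hn, add_re, add_im]
    ring
  neg_mem' := by
    rintro _ ⟨a, ha, rfl⟩
    refine ⟨-a, fun γ hγ => ?_, by ext <;> simp⟩
    obtain ⟨m, hm⟩ := ha γ hγ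
    refine ⟨-m, ?_⟩
    push_cast
    rw [← hm, neg_re, neg_im]
    ring

/-- The Floquet spectrum `Γ = Γ̂ / Λ*` at the zero energy level, a subset of `ℂ² / Λ*`. -/
def floquetSpectrum (Λ : Submodule ℤ ℂ) (U V : ℂ → ℂ) : Set ((ℂ × ℂ) ⧸ dualLattice Λ) :=
  QuotientAddGroup.mk '' quasiImpulses Λ U V

/-- The conjugate-linear map `(k₁, k₂) ↦ (k̄₁, k̄₂)`. -/
def conjK : (ℂ × ℂ) →ₗ⋆[ℂ] (ℂ × ℂ) where
  toFun k := (conj k.1, conj k.2)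
  map_add' _ _ := by simp
  map_smul' _ _ := by simp

/-- The conjugate-linear map `(k₁, k₂) ↦ (-k̄₁, -k̄₂)`. -/
def negConjK : (ℂ × ℂ) →ₗ⋆[ℂ] (ℂ × ℂ) where
  toFun k := (-conj k.1, -conj k.2)
  map_add' _ _ := by simp [add_comm]
  map_smul' _ _ := by simp

theorem dualLattice_le_comap_conjK (Λ : Submodule ℤ ℂ) :
    dualLattice Λ ≤ (dualLattice Λ).comap conjK.toAddMonoidHom := by
  rintro _ ⟨a, ha, rfl⟩
  exact ⟨a, ha, by simp [conjK]⟩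

theorem dualLattice_le_comap_negConjK (Λ : Submodule ℤ ℂ) :
    dualLattice Λ ≤ (dualLattice Λ).comap negConjK.toAddMonoidHom := by
  intro k hk
  obtain ⟨a, ha, h⟩ := (dualLattice Λ).neg_mem hk
  refine ⟨a, ha, ?_⟩
  rw [neg_eq_iff_eq_neg] at h
  subst h
  simp [negConjK]

/-- The map of `ℂ² / Λ*` induced by `(k₁, k₂) ↦ (k̄₁, k̄₂)`. -/
def conjQ (Λ : Submodule ℤ ℂ) : (ℂ × ℂ) ⧸ dualLattice Λ →+ (ℂ × ℂ) ⧸ dualLattice Λ :=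
  QuotientAddGroup.map _ _ conjK.toAddMonoidHom (dualLattice_le_comap_conjK Λ)

/-- The map of `ℂ² / Λ*` induced by `(k₁, k₂) ↦ (-k̄₁, -k̄₂)`. -/
def negConjQ (Λ : Submodule ℤ ℂ) : (ℂ × ℂ) ⧸ dualLattice Λ →+ (ℂ × ℂ) ⧸ dualLattice Λ :=
  QuotientAddGroup.map _ _ negConjK.toAddMonoidHom (dualLattice_le_comap_negConjK Λ)

end DiracFloquet

end

/-! The first symmetry is explicit. Conjugation exchanges `∂` and `∂̄` and turns the multiplier of
`k` into that of `-k̄`, so for `U = V̄` the pair `(ψ̄₂, -ψ̄₁)` is again a Floquet function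
(`IsFloquetFunction.conj`).

The second symmetry comes from the adjoint operator. A Floquet function is the exponential of `k`
times a function on the torus `ℂ / Λ`, and in Fourier coefficients the equation reads `D x = M x`:
here `D` is diagonal, with entries the symbols of `∂̄` and `∂` at `k` shifted by the dual lattice,
and `M` is bounded, made of multiplication by `V` and `-U` (`mem_quasiImpulses_iff`). The symbols
tend to infinity (`tendsto_norm_symbol`), so `D` has compact resolvent, and a nontrivial kernel of
`D - M` forces one of its adjoint (`exists_ne_zero_adjoint_of_exists_ne_zero`). For real potentials
the multiplications are self-adjoint, while conjugating the symbols replaces `k` by `k̄`, exchanges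
`∂` with `∂̄` and changes the sign (`conj_symbol_add_dualVector`). After a swap and a sign change
the adjoint system is therefore the original system at `k̄`.

Both maps are involutions, so invariance of the set already gives equality with its image. -/

noncomputable section

/-! ### Diagonal operators and a Fredholm alternative -/

namespace HilbertBasis

open Filter Topology
open scoped NNReal

variable {ι H : Type*} [NormedAddCommGroup H] [InnerProductSpace ℂ H]

theorem ext_inner (b : HilbertBasis ι ℂ H) {x y : H}
    (h : ∀ i, inner ℂ (b i) x = inner ℂ (b i) y) : x = y := by
  apply b.repr.injective
  ext i
  simpa only [b.repr_apply_apply] using h i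

theorem norm_mul_repr_le (b : HilbertBasis ι ℂ H) {d : ι → ℂ} {C : ℝ≥0} (hd : ∀ i, ‖d i‖ ≤ C)
    (x : H) (i : ι) : ‖d i * b.repr x i‖ ≤ ‖b.repr ((C : ℂ) • x) i‖ := by
  have : b.repr ((C : ℂ) • x) i = C * b.repr x i := by
    rw [map_smul, lp.coeFn_smul, Pi.smul_apply, smul_eq_mul]
  rw [this, norm_mul, norm_mul]
  gcongr
  simpa using hd i

theorem memℓp_mul_repr (b : HilbertBasis ι ℂ H) {d : ι → ℂ} {C : ℝ≥0} (hd : ∀ i, ‖d i‖ ≤ C)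
    (x : H) : Memℓp (fun i => d i * b.repr x i) 2 :=
  (lp.memℓp (b.repr ((C : ℂ) • x))).mono' (b.norm_mul_repr_le hd x)

/-- The operator which multiplies the coordinates in a Hilbert basis by a bounded family. -/
def diagonal (b : HilbertBasis ι ℂ H) (d : ι → ℂ) (C : ℝ≥0) (hd : ∀ i, ‖d i‖ ≤ C) : H →L[ℂ] H :=
  LinearMap.mkContinuous
    { toFun := fun x => b.repr.symm ⟨fun i => d i * b.repr x i, b.memℓp_mul_repr hd x⟩
      map_add' := fun x y => by
        rw [← map_add]; congr 1; ext i
        simp only [map_add, lp.coeFn_add, Pi.add_apply, mul_add]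
      map_smul' := fun c x => by
        rw [RingHom.id_apply, ← map_smul]; congr 1; ext i
        simp only [map_smul, lp.coeFn_smul, Pi.smul_apply, smul_eq_mul, mul_left_comm] }
    C (fun x => by
      have := lp.norm_mono (p := 2) (by simp) 
        (x := (⟨fun i => d i * b.repr x i, b.memℓp_mul_repr hd x⟩ : lp (fun _ : ι => ℂ) 2))
        (y := b.repr ((C : ℂ) • x)) (b.norm_mul_repr_le hd x)
      simpa [norm_smul] using this)

theorem inner_diagonal (b : HilbertBasis ι ℂ H) {d : ι → ℂ} {C : ℝ≥0} (hd : ∀ i, ‖d i‖ ≤ C)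
    (x : H) (i : ι) : inner ℂ (b i) (b.diagonal d C hd x) = d i * inner ℂ (b i) x := by
  simp [diagonal, ← b.repr_apply_apply]

theorem norm_diagonal_le (b : HilbertBasis ι ℂ H) {d : ι → ℂ} {C : ℝ≥0} (hd : ∀ i, ‖d i‖ ≤ C) :
    ‖b.diagonal d C hd‖ ≤ C :=
  LinearMap.mkContinuous_norm_le _ C.2 _

theorem diagonal_apply_basis (b : HilbertBasis ι ℂ H) {d : ι → ℂ} {C : ℝ≥0} (hd : ∀ i, ‖d i‖ ≤ C)
    (i : ι) : b.diagonal d C hd (b i) = d i • b i := by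
  classical
  refine b.ext_inner fun j => ?_
  rw [inner_diagonal, inner_smul_right, orthonormal_iff_ite.mp b.orthonormal]
  split_ifs with h <;> simp [h]

theorem adjoint_diagonal [CompleteSpace H] (b : HilbertBasis ι ℂ H) {d : ι → ℂ} {C : ℝ≥0}
    (hd : ∀ i, ‖d i‖ ≤ C) :
    ContinuousLinearMap.adjoint (b.diagonal d C hd) =
      b.diagonal (fun i => conj (d i)) C (fun i => by simpa using hd i) := by
  ext x
  refine b.ext_inner fun i => ?_
  rw [ContinuousLinearMap.adjoint_inner_right, diagonal_apply_basis, inner_diagonal,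
    inner_smul_left]

/-- Truncation to a finite set of indices has finite rank. The remainder is diagonal with uniformly
small entries, so the operator is a norm limit of compact ones. -/
theorem isCompactOperator_diagonal [CompleteSpace H] (b : HilbertBasis ι ℂ H) {d : ι → ℂ}
    {C : ℝ≥0} (hd : ∀ i, ‖d i‖ ≤ C) (h0 : Tendsto d cofinite (𝓝 0)) :
    IsCompactOperator (b.diagonal d C hd) := by
  classical
  let F : Finset ι → H →L[ℂ] H := fun s => ∑ i ∈ s, (d i • innerSL ℂ (b i)).smulRight (b i)
  have hF : ∀ s x i, inner ℂ (b i) (F s x) = if i ∈ s then d i * inner ℂ (b i) x else 0 := by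
    intro s x i
    simp only [F, sum_apply, inner_sum, ContinuousLinearMap.smulRight_apply, inner_smul_right,
      orthonormal_iff_ite.mp b.orthonormal, smul_apply, innerSL_apply_apply]
    simp
  refine isCompactOperator_of_tendsto (l := atTop) (F := F) ?_ (.of_forall fun s => ?_)
  · rw [Metric.tendsto_atTop]
    intro ε hε
    have hfin : {i | ¬ ‖d i‖ < ε / 2}.Finite := by
      simpa using h0.norm.eventually (p := fun x : ℝ => x < ε / 2)
        (by rw [norm_zero]; exact gt_mem_nhds (by positivity))
    refine ⟨hfin.toFinset, fun s hs => ?_⟩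
    have hb : ∀ i, ‖(if i ∈ s then 0 else d i)‖ ≤ (Real.toNNReal (ε / 2) : ℝ≥0) := by
      intro i
      rw [Real.coe_toNNReal _ (by positivity)]
      split_ifs with hi
      · simp; positivity
      · by_contra hlt
        exact hi (hs (by simpa using (not_le.mp hlt).le))
    have : b.diagonal d C hd - F s = b.diagonal _ _ hb := by
      ext x
      refine b.ext_inner fun i => ?_
      rw [_root_.sub_apply, inner_sub_right, inner_diagonal, inner_diagonal, hF]
      split_ifs <;> simp
    rw [dist_comm, dist_eq_norm, this]
    refine (b.norm_diagonal_le hb).trans_lt ?_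
    rw [Real.coe_toNNReal _ (by positivity)]
    exact half_lt_self hε
  · have : ∀ i, IsCompactOperator ((d i • innerSL ℂ (b i)).smulRight (b i)) := fun i => by
      have h : IsCompactOperator (id : ℂ → ℂ) := isCompactOperator_id
      exact (h.comp_clm (d i • innerSL ℂ (b i))).clm_comp
        ((1 : ℂ →L[ℂ] ℂ).smulRight (b i))
    simp only [F]
    induction s using Finset.induction_on with
    | empty => simpa using isCompactOperator_zero
    | insert i s hi ih =>
      rw [Finset.sum_insert hi]
      exact (this i).add ih

/-- If `D` is a diagonal operator with compact resolvent and `M` is bounded, then the adjoint of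
`D - M` has a nontrivial kernel as soon as `D - M` has. -/
theorem exists_ne_zero_adjoint_of_exists_ne_zero [Countable ι] [CompleteSpace H]
    (b : HilbertBasis ι ℂ H) (d : ι → ℂ) (hd : Tendsto (fun i => ‖d i‖) cofinite atTop)
    (M : H →L[ℂ] H)
    (h : ∃ x : H, x ≠ 0 ∧ ∀ i, d i * inner ℂ (b i) x = inner ℂ (b i) (M x)) :
    ∃ y : H, y ≠ 0 ∧ ∀ i, conj (d i) * inner ℂ (b i) y = inner ℂ (M (b i)) y := by
  obtain ⟨x, hx0, hx⟩ := h
  -- As `ℂ` is uncountable, some shift `c` makes every `d i + c` nonzero; the inverse `S` of `D + c`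
  -- is then diagonal and compact.
  obtain ⟨c, hc⟩ : ∃ c : ℂ, c ∉ Set.range fun i => -d i := by
    by_contra! hcon
    exact not_countable_complex ((Set.countable_range _).mono fun c _ => hcon c)
  have hne : ∀ i, d i + c ≠ 0 := fun i hi => hc ⟨i, by simpa using (eq_neg_of_add_eq_zero_right hi).symm⟩
  have hs0 : Tendsto (fun i => (d i + c)⁻¹) cofinite (𝓝 0) := by
    rw [tendsto_zero_iff_norm_tendsto_zero]
    simp only [norm_inv]
    refine Tendsto.inv_tendsto_atTop (tendsto_atTop_mono (fun i => ?_)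
      (tendsto_atTop_add_const_right _ (-‖c‖) hd))
    have := norm_sub_le (d i + c) c
    simp at this
    linarith
  obtain ⟨C, hC⟩ : ∃ C : ℝ≥0, ∀ i, ‖(d i + c)⁻¹‖ ≤ C := by
    have hb := hs0.norm.bddAbove_range_of_cofinite
    obtain ⟨C, hC⟩ := hb
    exact ⟨C.toNNReal, fun i => (hC ⟨i, rfl⟩).trans (Real.le_coe_toNNReal C)⟩
  set S := b.diagonal _ C hC with hS
  have hScpt : IsCompactOperator S := b.isCompactOperator_diagonal hC hs0
  have hSadj : IsCompactOperator (ContinuousLinearMap.adjoint S) := by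
    rw [hS, adjoint_diagonal]
    refine b.isCompactOperator_diagonal _ ?_
    simpa [Function.comp_def] using (Complex.continuous_conj.tendsto 0).comp hs0
  set W : H →L[ℂ] H := M + c • 1 with hW
  -- `D x = M x` means `(D + c) x = W x`, that is `x = S W x`.
  have h1 : (1 : ℂ) ∈ spectrum ℂ (S * W) := by
    rw [← IsCompactOperator.hasEigenvalue_iff_mem_spectrum (hScpt.comp_clm W) one_ne_zero]
    refine Module.End.hasEigenvalue_of_hasEigenvector (x := x)
      ⟨Module.End.mem_eigenspace_iff.mpr ?_, hx0⟩
    rw [one_smul]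
    refine b.ext_inner fun i => ?_
    change inner ℂ (b i) (S (W x)) = _
    rw [hS, inner_diagonal, hW]
    simp only [add_apply, inner_add_right, ← hx i]
    simp only [smul_apply, one_apply_eq_self, inner_smul_right]
    field_simp [hne i]
  have h2 : (1 : ℂ) ∈ spectrum ℂ (star W * star S) := by
    rw [← star_mul, spectrum.map_star]
    simpa using h1
  -- Taking adjoints reverses the factors. Away from `0` the spectrum does not see their order, and
  -- a fixed vector of `star S * star W` is what solves the adjoint equation.
  have h3 : (1 : ℂ) ∈ spectrum ℂ (star S * star W) := by
    have : (1 : ℂ) ∈ spectrum ℂ (star W * star S) \ {0} := ⟨h2, by simp⟩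
    rw [spectrum.nonzero_mul_comm] at this
    exact this.1
  rw [← IsCompactOperator.hasEigenvalue_iff_mem_spectrum (hSadj.comp_clm (star W)) one_ne_zero]
    at h3
  obtain ⟨y, hy, hy0⟩ := h3.exists_hasEigenvector
  refine ⟨y, hy0, fun i => ?_⟩
  have hy' : star S (star W y) = y := by
    simpa using Module.End.mem_eigenspace_iff.mp hy
  have key : inner ℂ (b i) y = conj (d i + c)⁻¹ * inner ℂ (W (b i)) y := by
    conv_lhs => rw [← hy']
    rw [ContinuousLinearMap.star_eq_adjoint, ContinuousLinearMap.star_eq_adjoint,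
      ContinuousLinearMap.adjoint_inner_right, hS, diagonal_apply_basis, inner_smul_left,
      ContinuousLinearMap.adjoint_inner_right]
  have key2 : conj (d i + c) * inner ℂ (b i) y = inner ℂ (W (b i)) y := by
    rw [key, ← mul_assoc, ← map_mul, mul_inv_cancel₀ (hne i), map_one, one_mul]
  rw [hW] at key2
  simp only [add_apply, smul_apply,
    one_apply_eq_self, inner_add_left, inner_smul_left, map_add, add_mul] at key2
  exact add_right_cancel key2

theorem _root_.orthonormal_sumElim_toLp_prod {ι' H' : Type*} [NormedAddCommGroup H']
    [InnerProductSpace ℂ H'] {v : ι → H} {w : ι' → H'} (hv : Orthonormal ℂ v)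
    (hw : Orthonormal ℂ w) :
    Orthonormal ℂ (Sum.elim (fun i => WithLp.toLp 2 (v i, (0 : H')))
      (fun j => WithLp.toLp 2 ((0 : H), w j))) := by
  classical
  rw [orthonormal_iff_ite] at hv hw ⊢
  rintro (i | i) (j | j) <;> simp [hv, hw]

/-- The Hilbert basis of a product made of Hilbert bases of the factors. -/
def prod {ι' H' : Type*} [NormedAddCommGroup H'] [InnerProductSpace ℂ H'] [CompleteSpace H]
    [CompleteSpace H'] (b : HilbertBasis ι ℂ H) (b' : HilbertBasis ι' ℂ H') :
    HilbertBasis (ι ⊕ ι') ℂ (WithLp 2 (H × H')) :=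
  HilbertBasis.mkOfOrthogonalEqBot
    (orthonormal_sumElim_toLp_prod b.orthonormal b'.orthonormal) (by
    rw [Submodule.eq_bot_iff]
    intro x hx
    rw [Submodule.mem_orthogonal] at hx
    have h1 : x.fst = 0 := b.ext_inner fun i => by
      simpa using hx _ (Submodule.subset_span ⟨Sum.inl i, rfl⟩)
    have h2 : x.snd = 0 := b'.ext_inner fun i => by
      simpa using hx _ (Submodule.subset_span ⟨Sum.inr i, rfl⟩)
    exact (WithLp.ofLp_injective 2) (Prod.ext h1 h2))

theorem prod_inl {ι' H' : Type*} [NormedAddCommGroup H'] [InnerProductSpace ℂ H']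
    [CompleteSpace H] [CompleteSpace H'] (b : HilbertBasis ι ℂ H) (b' : HilbertBasis ι' ℂ H')
    (i : ι) : b.prod b' (Sum.inl i) = WithLp.toLp 2 (b i, 0) := by
  simp [prod]

theorem prod_inr {ι' H' : Type*} [NormedAddCommGroup H'] [InnerProductSpace ℂ H']
    [CompleteSpace H] [CompleteSpace H'] (b : HilbertBasis ι ℂ H) (b' : HilbertBasis ι' ℂ H')
    (i : ι') : b.prod b' (Sum.inr i) = WithLp.toLp 2 (0, b' i) := by
  simp [prod]

/-- A diagonal system coupled by bounded operators has a nonzero solution only if the adjoint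
system has one. -/
theorem exists_adjoint_system [Countable ι] [CompleteSpace H] (b : HilbertBasis ι ℂ H)
    (d₁ d₂ : ι → ℂ) (hd₁ : Tendsto (fun i => ‖d₁ i‖) cofinite atTop)
    (hd₂ : Tendsto (fun i => ‖d₂ i‖) cofinite atTop) (A B : H →L[ℂ] H)
    (h : ∃ x₁ x₂ : H, ¬ (x₁ = 0 ∧ x₂ = 0) ∧
      (∀ i, d₁ i * inner ℂ (b i) x₁ = inner ℂ (b i) (A x₂)) ∧
      ∀ i, d₂ i * inner ℂ (b i) x₂ = inner ℂ (b i) (B x₁)) :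
    ∃ y₁ y₂ : H, ¬ (y₁ = 0 ∧ y₂ = 0) ∧
      (∀ i, conj (d₁ i) * inner ℂ (b i) y₁ = inner ℂ (B (b i)) y₂) ∧
      ∀ i, conj (d₂ i) * inner ℂ (b i) y₂ = inner ℂ (A (b i)) y₁ := by
  obtain ⟨x₁, x₂, hx0, hx₁, hx₂⟩ := h
  let e := WithLp.prodContinuousLinearEquiv 2 ℂ H H
  let M : WithLp 2 (H × H) →L[ℂ] WithLp 2 (H × H) :=
    (e.symm : H × H →L[ℂ] WithLp 2 (H × H)) ∘L
      ((A ∘L ContinuousLinearMap.snd ℂ H H).prod (B ∘L ContinuousLinearMap.fst ℂ H H)) ∘L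
      (e : WithLp 2 (H × H) →L[ℂ] H × H)
  have hM : ∀ u v : H, M (WithLp.toLp 2 (u, v)) = WithLp.toLp 2 (A v, B u) := fun u v => rfl
  have hd : Tendsto (fun i => ‖Sum.elim d₁ d₂ i‖) cofinite atTop := by
    rw [tendsto_atTop] at hd₁ hd₂ ⊢
    intro r
    refine (((eventually_cofinite.mp (hd₁ r)).image Sum.inl).union
      ((eventually_cofinite.mp (hd₂ r)).image Sum.inr)).subset ?_
    rintro (i | i) hi
    · exact Or.inl ⟨i, hi, rfl⟩
    · exact Or.inr ⟨i, hi, rfl⟩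
  have hx : ∃ x, x ≠ 0 ∧ ∀ i, Sum.elim d₁ d₂ i * inner ℂ (b.prod b i) x =
      inner ℂ (b.prod b i) (M x) := by
    refine ⟨WithLp.toLp 2 (x₁, x₂), fun h0 => hx0 (by simpa using h0), ?_⟩
    rintro (i | i)
    · simpa [prod_inl, hM] using hx₁ i
    · simpa [prod_inr, hM] using hx₂ i
  obtain ⟨y, hy0, hy⟩ := (b.prod b).exists_ne_zero_adjoint_of_exists_ne_zero _ hd M hx
  refine ⟨y.fst, y.snd, fun h0 => hy0 ((WithLp.ofLp_injective 2) (Prod.ext h0.1 h0.2)),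
    fun i => ?_, fun i => ?_⟩
  · simpa [prod_inl, hM] using hy (Sum.inl i)
  · simpa [prod_inr, hM] using hy (Sum.inr i)

end HilbertBasis

end

/-! ### The torus as a quotient of the plane -/

noncomputable section

namespace DiracFloquet

open Filter Topology UnitAddTorus

/-- The measure on `ℝ / ℤ` is normalised to have total volume 1. -/
local instance : MeasureSpace UnitAddCircle := ⟨AddCircle.haarAddCircle⟩

local instance : Measure.IsAddHaarMeasure (volume : Measure UnitAddCircle) :=
  inferInstanceAs (Measure.IsAddHaarMeasure AddCircle.haarAddCircle)

local instance : IsProbabilityMeasure (volume : Measure UnitAddCircle) :=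
  inferInstanceAs (IsProbabilityMeasure AddCircle.haarAddCircle)

variable (b : Module.Basis (Fin 2) ℝ ℂ)

/-- The projection of `ℂ` onto the torus `ℂ / (ℤ b₁ + ℤ b₂)`, identified with `(ℝ / ℤ)²`. -/
def torusProj (z : ℂ) : UnitAddTorus (Fin 2) := fun i => (b.equivFun z i : UnitAddCircle)

theorem continuous_equivFun : Continuous b.equivFun :=
  (b.equivFun : ℂ →ₗ[ℝ] (Fin 2 → ℝ)).continuous_of_finiteDimensional

theorem continuous_torusProj : Continuous (torusProj b) :=
  continuous_pi fun i =>
    (AddCircle.continuous_mk' 1).comp ((continuous_apply i).comp (continuous_equivFun b))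

theorem measurable_torusProj : Measurable (torusProj b) := (continuous_torusProj b).measurable

theorem torusProj_add (z w : ℂ) : torusProj b (z + w) = torusProj b z + torusProj b w := by
  funext i; simp [torusProj]

theorem torusProj_sub (z w : ℂ) : torusProj b (z - w) = torusProj b z - torusProj b w := by
  funext i; simp [torusProj]

theorem torusProj_eq_zero_iff (z : ℂ) :
    torusProj b z = 0 ↔ z ∈ Submodule.span ℤ (Set.range b) := by
  rw [b.mem_span_iff_repr_mem ℤ]
  simp [torusProj, funext_iff, b.equivFun_apply, Set.mem_range, AddSubgroup.mem_zmultiples_iff]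

/-- The period parallelogram with corner `a`, in the coordinates given by the basis. -/
def periodCell (a : Fin 2 → ℝ) : Set ℂ := b.equivFun ⁻¹' {x | ∀ i, x i ∈ Set.Ioc (a i) (a i + 1)}

theorem measurableSet_periodCell (a : Fin 2 → ℝ) : MeasurableSet (periodCell b a) :=
  (continuous_equivFun b).measurable (MeasurableSet.univ_pi' fun _ => measurableSet_Ioc)

/-- A section of the projection onto the torus with values in a period parallelogram. -/
def torusSection (t : UnitAddTorus (Fin 2)) : ℂ :=
  b.equivFun.symm (measurableEquivPiIoc 0 t).1

theorem torusProj_torusSection (t : UnitAddTorus (Fin 2)) :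
    torusProj b (torusSection b t) = t := by
  have := (measurableEquivPiIoc (0 : Fin 2 → ℝ)).symm_apply_apply t
  rw [coe_symm_measurableEquivPiIoc_apply] at this
  unfold torusProj torusSection
  rw [b.equivFun.apply_symm_apply]
  exact this

/-- By uniqueness of Haar measure the pushforward is a multiple of `ν`. Only finiteness and
nonvanishing of the factor matter later, so it is never computed. -/
theorem exists_measurePreserving_continuousLinearEquiv {E F : Type*} [NormedAddCommGroup E]
    [NormedSpace ℝ E] [NormedAddCommGroup F] [NormedSpace ℝ F] [MeasurableSpace E] [BorelSpace E]
    [MeasurableSpace F] [BorelSpace F] [FiniteDimensional ℝ F]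
    (e : E ≃L[ℝ] F) (μ : Measure E) [μ.IsAddHaarMeasure] (ν : Measure F)
    [ν.IsAddHaarMeasure] :
    ∃ c : ℝ≥0∞, c ≠ 0 ∧ c ≠ ⊤ ∧ MeasurePreserving e μ (c • ν) := by
  have := e.isAddHaarMeasure_map μ
  have : ProperSpace F := FiniteDimensional.proper_real F
  refine ⟨Measure.addHaarScalarFactor (μ.map e) ν, ?_, ENNReal.coe_ne_top,
    e.continuous.measurable, Measure.isAddLeftInvariant_eq_smul (μ.map e) ν⟩
  exact_mod_cast (Measure.addHaarScalarFactor_pos_of_isAddHaarMeasure (μ.map e) ν).ne'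

theorem measurePreserving_coe_unitAddTorus (a : Fin 2 → ℝ) :
    MeasurePreserving (fun (x : Fin 2 → ℝ) i => (x i : UnitAddCircle))
      (volume.restrict {x | ∀ i, x i ∈ Set.Ioc (a i) (a i + 1)}) volume := by
  have hm : Measurable (fun (x : Fin 2 → ℝ) i => (x i : UnitAddCircle)) :=
    measurable_pi_lambda _ fun i => AddCircle.measurable_mk'.comp (measurable_pi_apply i)
  refine ⟨hm, Measure.ext fun s hs => ?_⟩
  rw [Measure.map_apply hm hs, ← lintegral_indicator_one hs, ← lintegral_indicator_one (hm hs),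
    lintegral_preimage _ a]
  rfl

theorem exists_measurePreserving_torusProj : ∃ c : ℝ≥0∞, c ≠ 0 ∧ c ≠ ⊤ ∧
    ∀ a, MeasurePreserving (torusProj b) (volume.restrict (periodCell b a)) (c • volume) := by
  obtain ⟨c, hc0, hc, h⟩ :=
    exists_measurePreserving_continuousLinearEquiv b.equivFunL volume volume
  refine ⟨c, hc0, hc, fun a => ?_⟩
  have h1 := h.restrict_preimage (s := {x | ∀ i, x i ∈ Set.Ioc (a i) (a i + 1)})
    (MeasurableSet.univ_pi' fun _ => measurableSet_Ioc)
  rw [Measure.restrict_smul] at h1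
  exact ((measurePreserving_coe_unitAddTorus a).smul_measure c).comp h1

theorem exists_measurePreserving_torusSection : ∃ c : ℝ≥0∞, c ≠ 0 ∧ c ≠ ⊤ ∧
    MeasurePreserving (torusSection b) volume (c • volume.restrict (periodCell b 0)) := by
  obtain ⟨c, hc0, hc, h⟩ :=
    exists_measurePreserving_continuousLinearEquiv b.equivFunL.symm volume volume
  refine ⟨c, hc0, hc, ?_⟩
  have h1 := h.restrict_preimage (measurableSet_periodCell b 0)
  have hs : b.equivFunL.symm ⁻¹' periodCell b 0 =
      {x : Fin 2 → ℝ | ∀ i, x i ∈ Set.Ioc ((0 : Fin 2 → ℝ) i) ((0 : Fin 2 → ℝ) i + 1)} := by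
    ext x
    simp only [periodCell, Set.mem_preimage]
    exact iff_of_eq (congrArg _ (b.equivFunL.apply_symm_apply x))
  rw [hs, Measure.restrict_smul] at h1
  exact h1.comp ((measurePreserving_subtype_coe
    (MeasurableSet.univ_pi' fun _ => measurableSet_Ioc)).comp (measurePreserving_equivPiIoc 0))

/-- The period parallelogram centred at a point. -/
def centredCell (z : ℂ) : Set ℂ := periodCell b fun i => b.equivFun z i - 1 / 2

theorem centredCell_mem_nhds (z : ℂ) : centredCell b z ∈ 𝓝 z := by
  refine (continuous_equivFun b).continuousAt.preimage_mem_nhds ?_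
  have := set_pi_mem_nhds (Set.finite_univ (α := Fin 2)) (x := b.equivFun z)
    (s := fun i => Set.Ioc (b.equivFun z i - 1 / 2) (b.equivFun z i - 1 / 2 + 1))
    fun i _ => Ioc_mem_nhds (by linarith) (by linarith)
  simpa [Set.pi] using this

/-- Each point is interior to its centred cell, where the projection preserves measure up to a
factor; finitely many cells cover a compact set. -/
theorem exists_map_torusProj_le {K : Set ℂ} (hK : IsCompact K) :
    ∃ C : ℝ≥0∞, C ≠ ⊤ ∧ (volume.restrict K).map (torusProj b) ≤ C • volume := by
  obtain ⟨c, -, hc, h⟩ := exists_measurePreserving_torusProj b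
  refine hK.induction_on ⟨0, by simp⟩ ?_ ?_ ?_
  · rintro s t hst ⟨C, hC, hle⟩
    exact ⟨C, hC, (Measure.map_mono (Measure.restrict_mono hst le_rfl)
      (measurable_torusProj b)).trans hle⟩
  · rintro s t ⟨C, hC, hle⟩ ⟨C', hC', hle'⟩
    refine ⟨C + C', by simp [hC, hC'], ?_⟩
    refine (Measure.map_mono (Measure.restrict_union_le s t) (measurable_torusProj b)).trans ?_
    rw [Measure.map_add _ _ (measurable_torusProj b), add_smul]
    exact add_le_add hle hle'
  · intro z _
    exact ⟨centredCell b z, mem_nhdsWithin_of_mem_nhds (centredCell_mem_nhds b z), c, hc,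
      (h _).map_eq.le⟩

theorem quasiMeasurePreserving_torusProj :
    Measure.QuasiMeasurePreserving (torusProj b) volume volume := by
  refine ⟨measurable_torusProj b, Measure.AbsolutelyContinuous.mk fun N hN h0 => ?_⟩
  rw [Measure.map_apply (measurable_torusProj b) hN]
  refine measure_null_of_locally_null _ fun z _ => ?_
  obtain ⟨c, -, -, h⟩ := exists_measurePreserving_torusProj b
  refine ⟨_, inter_mem_nhdsWithin _ (centredCell_mem_nhds b z), ?_⟩
  rw [← Measure.restrict_apply ((measurable_torusProj b) hN), centredCell,
    (h _).measure_preimage hN.nullMeasurableSet]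
  simp [h0]

theorem quasiMeasurePreserving_torusSection :
    Measure.QuasiMeasurePreserving (torusSection b) volume volume := by
  obtain ⟨c, hc0, hc, h⟩ := exists_measurePreserving_torusSection b
  refine ⟨h.measurable, ?_⟩
  rw [h.map_eq]
  exact (Measure.smul_absolutelyContinuous).trans Measure.restrict_le_self.absolutelyContinuous

theorem memLp_comp_torusSection {f : ℂ → ℂ} (hf : IsLocallyL2 f) :
    MemLp (f ∘ torusSection b) 2 volume := by
  obtain ⟨c, hc0, hc, h⟩ := exists_measurePreserving_torusSection b
  refine MemLp.comp_measurePreserving (MemLp.smul_measure ?_ hc) h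
  have hK : IsCompact (b.equivFunL ⁻¹' Set.Icc (0 : Fin 2 → ℝ) 1) :=
    b.equivFunL.toHomeomorph.isCompact_preimage.mpr isCompact_Icc
  refine (hf _ hK).mono_measure (Measure.restrict_mono (fun z hz => ?_) le_rfl)
  have hz' : ∀ i, b.equivFun z i ∈ Set.Ioc (0 : ℝ) (0 + 1) := hz
  exact ⟨fun i => (hz' i).1.le, fun i => by simpa using (hz' i).2⟩

theorem isLocallyL2_comp_torusProj {f : UnitAddTorus (Fin 2) → ℂ} (hf : MemLp f 2 volume) :
    IsLocallyL2 (f ∘ torusProj b) := by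
  intro K hK
  obtain ⟨C, hC, h⟩ := exists_map_torusProj_le b hK
  exact ((hf.smul_measure hC).mono_measure h).comp_of_map (measurable_torusProj b).aemeasurable

/-- A point and its representative differ by a lattice vector that depends on the point.
Countability of `Λ` allows one null set to serve all lattice vectors. -/
theorem eq_comp_torusSection_torusProj {Λ : Submodule ℤ ℂ} [Countable Λ]
    (hb : Submodule.span ℤ (Set.range b) = Λ) {f : ℂ → ℂ} (hf : IsPeriodic Λ f) :
    ∀ᵐ z, f z = f (torusSection b (torusProj b z)) := by
  have : ∀ᵐ z, ∀ γ : Λ, f (z + γ) = f z := ae_all_iff.mpr fun γ => hf γ γ.2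
  filter_upwards [this] with z hz
  have hm : torusSection b (torusProj b z) - z ∈ Λ := by
    rw [← hb, ← torusProj_eq_zero_iff, torusProj_sub, torusProj_torusSection, sub_self]
  simpa using (hz ⟨_, hm⟩).symm

/-! ### Exponentials and Wirtinger derivatives -/

/-- The vector in `ℝ² ⊆ ℂ²` dual to the lattice for which the multiplier is the `n`-th monomial. -/
def dualVector (n : Fin 2 → ℤ) : ℂ × ℂ :=
  (((∑ i, n i * b.equivFun 1 i : ℝ) : ℂ), ((∑ i, n i * b.equivFun I i : ℝ) : ℂ))

theorem multiplier_add (k l : ℂ × ℂ) (z : ℂ) :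
    multiplier (k + l) z = multiplier k z * multiplier l z := by
  rw [multiplier, multiplier, multiplier, ← Complex.exp_add, Prod.fst_add, Prod.snd_add]
  congr 1; ring

theorem multiplier_apply_add (k : ℂ × ℂ) (z w : ℂ) :
    multiplier k (z + w) = multiplier k z * multiplier k w := by
  rw [multiplier, multiplier, multiplier, ← Complex.exp_add, add_re, add_im]
  congr 1; push_cast; ring

theorem multiplier_neg_mul (k : ℂ × ℂ) (z : ℂ) : multiplier (-k) z * multiplier k z = 1 := by
  rw [← multiplier_add, neg_add_cancel]; simp [multiplier]

theorem multiplier_ne_zero (k : ℂ × ℂ) (z : ℂ) : multiplier k z ≠ 0 := Complex.exp_ne_zero _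

theorem mFourier_torusProj (n : Fin 2 → ℤ) (z : ℂ) :
    mFourier n (torusProj b z) = multiplier (dualVector b n) z := by
  have hz : b.equivFun z = z.re • b.equivFun 1 + z.im • b.equivFun I := by
    rw [← map_smul, ← map_smul, ← map_add]; congr 1; simp
  simp only [mFourier, ContinuousMap.coe_mk, torusProj, fourier_coe_apply, multiplier, dualVector,
    hz, Fin.prod_univ_two, Fin.sum_univ_two, ← Complex.exp_add]
  congr 1
  simp
  ring

/-- The first order operator `(∂ₓ + σ i ∂_y) / 2`, which is `∂̄` for `σ = 1` and `∂` for
`σ = -1`. -/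
def wirtinger (σ : ℂ) (η : ℂ → ℂ) (z : ℂ) : ℂ :=
  (fderiv ℝ η z 1 + σ * I * fderiv ℝ η z I) / 2

theorem dz_eq_wirtinger : dz = wirtinger (-1) := by
  ext η z; simp [dz, wirtinger, sub_eq_add_neg]

theorem dzbar_eq_wirtinger : dzbar = wirtinger 1 := by
  ext η z; simp [dzbar, wirtinger]

/-- The symbol of `wirtinger σ` at the exponential with quasi-impulses `k`. -/
def symbol (σ : ℂ) (k : ℂ × ℂ) : ℂ := Real.pi * I * (k.1 + σ * I * k.2)

theorem symbol_neg (σ : ℂ) (k : ℂ × ℂ) : symbol σ (-k) = -symbol σ k := by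
  simp [symbol]; ring

theorem hasFDerivAt_multiplier (k : ℂ × ℂ) (z : ℂ) :
    HasFDerivAt (multiplier k) (multiplier k z •
      ((2 * Real.pi * I * k.1) • (ofRealCLM ∘L reCLM) +
        (2 * Real.pi * I * k.2) • (ofRealCLM ∘L imCLM))) z := by
  have h : multiplier k = fun z => Complex.exp
      (((2 * Real.pi * I * k.1) • (ofRealCLM ∘L reCLM) +
        (2 * Real.pi * I * k.2) • (ofRealCLM ∘L imCLM)) z) := by
    ext z
    simp [multiplier]
    congr 1; ring
  rw [h]
  exact (ContinuousLinearMap.hasFDerivAt _).cexp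

theorem contDiff_multiplier (k : ℂ × ℂ) : ContDiff ℝ ∞ (multiplier k) := by
  unfold multiplier
  have h1 : ContDiff ℝ ∞ fun z : ℂ => (z.re : ℂ) := (ofRealCLM ∘L reCLM).contDiff
  have h2 : ContDiff ℝ ∞ fun z : ℂ => (z.im : ℂ) := (ofRealCLM ∘L imCLM).contDiff
  fun_prop

theorem wirtinger_multiplier (σ : ℂ) (k : ℂ × ℂ) (z : ℂ) :
    wirtinger σ (multiplier k) z = symbol σ k * multiplier k z := by
  rw [wirtinger, (hasFDerivAt_multiplier k z).fderiv]
  simp [symbol]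
  ring

theorem wirtinger_mul (σ : ℂ) {f g : ℂ → ℂ} {z : ℂ} (hf : DifferentiableAt ℝ f z)
    (hg : DifferentiableAt ℝ g z) :
    wirtinger σ (fun z => f z * g z) z = wirtinger σ f z * g z + f z * wirtinger σ g z := by
  simp only [wirtinger, fderiv_fun_mul hf hg, add_apply, smul_apply, smul_eq_mul]
  ring

theorem wirtinger_comp_sub (σ : ℂ) (f : ℂ → ℂ) (w z : ℂ) :
    wirtinger σ (fun z => f (z - w)) z = wirtinger σ f (z - w) := by
  simp [wirtinger, fderiv_comp_sub]

theorem continuous_wirtinger (σ : ℂ) {η : ℂ → ℂ} (hη : ContDiff ℝ ∞ η) :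
    Continuous (wirtinger σ η) := by
  have h := hη.continuous_fderiv (by simp)
  unfold wirtinger
  fun_prop

theorem hasCompactSupport_wirtinger (σ : ℂ) {η : ℂ → ℂ} (hη : HasCompactSupport η) :
    HasCompactSupport (wirtinger σ η) :=
  (hη.fderiv ℝ).comp_left (g := fun L : ℂ →L[ℝ] ℂ => (L 1 + σ * I * L I) / 2) (by simp)

theorem integral_wirtinger (σ : ℂ) {η : ℂ → ℂ} (hη : ContDiff ℝ ∞ η)
    (hs : HasCompactSupport η) : ∫ z, wirtinger σ η z = 0 := by
  have hc := hη.continuous_fderiv (by simp)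
  have hi : ∀ v, Integrable fun z => fderiv ℝ η z v := fun v =>
    (hc.clm_apply continuous_const).integrable_of_hasCompactSupport
      ((hs.fderiv ℝ).comp_left (g := fun L : ℂ →L[ℝ] ℂ => L v) (by simp))
  have h : ∀ v, ∫ z, fderiv ℝ η z v = 0 := fun v => by
    simpa using integral_mul_fderiv_eq_neg_fderiv_mul_of_integrable (μ := volume)
      (f := fun _ : ℂ => (1 : ℂ)) (g := η) (v := v) (by simp) (by simpa using hi v)
      (by simpa using hη.continuous.integrable_of_hasCompactSupport hs)
      (fun x _ => differentiableAt_const _) (fun x _ => hη.differentiable (by simp) x)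
  simp only [wirtinger]
  rw [integral_div, integral_add (hi 1) ((hi I).const_mul _), integral_const_mul, h, h]
  simp

theorem integral_multiplier_mul_wirtinger (σ : ℂ) (k : ℂ × ℂ) {η : ℂ → ℂ}
    (hη : ContDiff ℝ ∞ η) (hs : HasCompactSupport η) :
    ∫ z, multiplier k z * wirtinger σ η z = -(symbol σ k * ∫ z, multiplier k z * η z) := by
  have hm := contDiff_multiplier k
  have h := integral_wirtinger σ (hm.mul hη) (hs.mul_left)
  have h2 : ∀ z, wirtinger σ (fun z => multiplier k z * η z) z =
      symbol σ k * (multiplier k z * η z) + multiplier k z * wirtinger σ η z := fun z => by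
    rw [wirtinger_mul σ (hm.differentiable (by simp) z) (hη.differentiable (by simp) z),
      wirtinger_multiplier, mul_assoc]
  simp only [h2] at h
  rw [integral_add, integral_const_mul] at h
  · exact (neg_eq_of_add_eq_zero_right h).symm
  · exact ((hm.continuous.mul hη.continuous).integrable_of_hasCompactSupport hs.mul_left).const_mul _
  · exact (hm.continuous.mul (continuous_wirtinger σ hη)).integrable_of_hasCompactSupport
      (hasCompactSupport_wirtinger σ hs).mul_left

/-! ### Weak equations in Fourier coefficients -/

/-- After Fubini, translation invariance makes the integral over `t` independent of `u`. Averaging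
over translations thus extracts Fourier coefficients from integrals over the plane. -/
theorem integral_integral_torus {P : UnitAddTorus (Fin 2) → ℂ} (hP : StronglyMeasurable P)
    (hPi : Integrable P) {Φ : ℂ → ℂ} (hΦ : Continuous Φ) (hs : HasCompactSupport Φ) :
    ∫ t, ∫ u, P (torusProj b u + t) * Φ u = (∫ t, P t) * ∫ u, Φ u := by
  have hmeas : StronglyMeasurable (Function.uncurry fun t u => P (torusProj b u + t) * Φ u) := by
    refine (hP.comp_measurable ?_).mul (hΦ.stronglyMeasurable.comp_measurable measurable_snd)
    exact ((measurable_torusProj b).comp measurable_snd).add measurable_fst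
  have hshift : ∀ s, Integrable fun t => P (s + t) := fun s =>
    hPi.comp_add_left (μ := (volume : Measure (UnitAddTorus (Fin 2)))) s
  rw [integral_integral_swap]
  · simp only [integral_mul_const]
    simp only [integral_add_left_eq_self, integral_const_mul]
  · rw [integrable_prod_iff' hmeas.aestronglyMeasurable]
    refine ⟨.of_forall fun u => (hshift (torusProj b u)).mul_const (Φ u), ?_⟩
    simp only [Function.uncurry_apply_pair, norm_mul, integral_mul_const]
    simp only [integral_add_left_eq_self fun t => ‖P t‖]
    exact ((hΦ.integrable_of_hasCompactSupport hs).norm).const_mul _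

theorem dualVector_neg (n : Fin 2 → ℤ) : dualVector b (-n) = -dualVector b n := by
  simp [dualVector, Fin.sum_univ_two]

/-- The weak equation `wirtinger σ f = g` for Bloch functions, in terms of Fourier
coefficients. -/
theorem symbol_mul_mFourierCoeff {σ : ℂ} {f g : ℂ → ℂ}
    (h : ∀ η : ℂ → ℂ, ContDiff ℝ ∞ η → HasCompactSupport η →
      ∫ z, f z * wirtinger σ η z = -∫ z, g z * η z)
    {p q : UnitAddTorus (Fin 2) → ℂ} (hp : StronglyMeasurable p) (hpi : Integrable p)
    (hq : StronglyMeasurable q) (hqi : Integrable q) {k : ℂ × ℂ}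
    (hf : ∀ᵐ z, f z = multiplier k z * p (torusProj b z))
    (hg : ∀ᵐ z, g z = multiplier k z * q (torusProj b z)) (n : Fin 2 → ℤ) :
    symbol σ (k + dualVector b n) * mFourierCoeff p n = mFourierCoeff q n := by
  let B : ContDiffBump (0 : ℂ) := ⟨1, 2, by norm_num, by norm_num⟩
  let φ : ℂ → ℂ := fun z => (B.normed volume z : ℝ)
  have hφ : ContDiff ℝ ∞ φ := ofRealCLM.contDiff.comp B.contDiff_normed
  have hφs : HasCompactSupport φ := B.hasCompactSupport_normed.comp_left (g := ofReal) ofReal_zero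
  have hφ1 : ∫ z, φ z = 1 := by
    refine (integral_ofReal (𝕜 := ℂ) (f := B.normed volume)).trans ?_
    rw [B.integral_normed]
    simp
  set κ := k + dualVector b n with hκ
  -- For the test function `φ (z - w)` times the exponential of `-κ`, the derivative is `Φ (z - w)`
  -- times that exponential. Against the factor `multiplier k` only the monomial of index `-n`
  -- remains.
  let Φ : ℂ → ℂ := fun z => wirtinger σ φ z - symbol σ κ * φ z
  have hΦc : Continuous Φ := (continuous_wirtinger σ hφ).sub (hφ.continuous.const_mul _)
  have hΦs : HasCompactSupport Φ :=
    (hasCompactSupport_wirtinger σ hφs).sub hφs.mul_left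
  have hΦ1 : ∫ z, Φ z = -symbol σ κ := by
    simp only [Φ]
    rw [integral_sub ((continuous_wirtinger σ hφ).integrable_of_hasCompactSupport
      (hasCompactSupport_wirtinger σ hφs))
      ((hφ.continuous.integrable_of_hasCompactSupport hφs).const_mul _), integral_const_mul,
      integral_wirtinger σ hφ hφs, hφ1]
    simp
  have hexp : ∀ z, multiplier k z * multiplier (-κ) z = mFourier (-n) (torusProj b z) := by
    intro z
    rw [mFourier_torusProj, ← multiplier_add, dualVector_neg, hκ]
    congr 1; abel
  have key : ∀ w, ∫ u, (mFourier (-n) (torusProj b u + torusProj b w) *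
      p (torusProj b u + torusProj b w)) * Φ u = -∫ u, (mFourier (-n)
        (torusProj b u + torusProj b w) * q (torusProj b u + torusProj b w)) * φ u := by
    intro w
    have hsub : ContDiff ℝ ∞ fun z => φ (z - w) := hφ.comp (contDiff_id.sub contDiff_const)
    have hm := contDiff_multiplier (-κ)
    have hw := h (fun z => φ (z - w) * multiplier (-κ) z) (hsub.mul hm)
      ((hφs.comp_homeomorph (Homeomorph.subRight w)).mul_right)
    rw [← integral_sub_right_eq_self _ w, ← integral_sub_right_eq_self
      (fun u => (mFourier (-n) (torusProj b u + torusProj b w) *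
        q (torusProj b u + torusProj b w)) * φ u) w]
    simp only [← torusProj_add, sub_add_cancel]
    convert! hw using 1
    · refine integral_congr_ae ?_
      filter_upwards [hf] with z hz
      rw [hz, wirtinger_mul σ (hsub.differentiable (by simp) z)
        (hm.differentiable (by simp) z), wirtinger_comp_sub, wirtinger_multiplier, symbol_neg,
        ← hexp]
      simp only [Φ]; ring
    · congr 1
      refine integral_congr_ae ?_
      filter_upwards [hg] with z hz
      rw [hz, ← hexp]; ring
  -- The identity depends on `w` only through its class, so it can be integrated over the torus.
  have key2 : ∀ t, ∫ u, (mFourier (-n) (torusProj b u + t) * p (torusProj b u + t)) * Φ u =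
      -∫ u, (mFourier (-n) (torusProj b u + t) * q (torusProj b u + t)) * φ u := by
    intro t
    simpa only [torusProj_torusSection] using key (torusSection b t)
  have hmul : ∀ {r : UnitAddTorus (Fin 2) → ℂ}, StronglyMeasurable r → Integrable r →
      StronglyMeasurable (fun t => mFourier (-n) t * r t) ∧
      Integrable (fun t => mFourier (-n) t * r t) := by
    intro r hr hri
    have hm := (mFourier (d := Fin 2) (-n)).continuous.stronglyMeasurable
    refine ⟨hm.mul hr, hri.bdd_mul hm.aestronglyMeasurable (c := 1) (.of_forall fun t => ?_)⟩
    exact ((mFourier (-n)).norm_coe_le_norm t).trans mFourier_norm.le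
  have hfin := integral_congr_ae (μ := volume) (.of_forall key2)
  rw [integral_neg, integral_integral_torus b (hmul hp hpi).1 (hmul hp hpi).2 hΦc hΦs,
    integral_integral_torus b (hmul hq hqi).1 (hmul hq hqi).2 hφ.continuous hφs, hΦ1, hφ1] at hfin
  simp only [mFourierCoeff, smul_eq_mul]
  linear_combination -hfin

theorem IsLocallyL2.locallyIntegrable {f : ℂ → ℂ} (hf : IsLocallyL2 f) : LocallyIntegrable f := by
  rw [locallyIntegrable_iff]
  intro K hK
  have : IsFiniteMeasure (volume.restrict K) := ⟨by simpa using hK.measure_lt_top⟩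
  exact (hf K hK).integrable (by norm_num)

theorem integrable_comp_torusProj_mul (p : Lp ℂ 2 (volume : Measure (UnitAddTorus (Fin 2))))
    {Φ : ℂ → ℂ} (hΦ : Continuous Φ) (hs : HasCompactSupport Φ) :
    Integrable fun z => p (torusProj b z) * Φ z := by
  have := (isLocallyL2_comp_torusProj b (Lp.memLp p)).locallyIntegrable
  simpa [mul_comm] using this.integrable_smul_left_of_hasCompactSupport hΦ hs

/-- Pairing of a function on the torus, lifted to the plane, with a test function. -/
theorem exists_pairing {Φ : ℂ → ℂ} (hΦ : Continuous Φ) (hs : HasCompactSupport Φ) :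
    ∃ L : Lp ℂ 2 (volume : Measure (UnitAddTorus (Fin 2))) →L[ℂ] ℂ,
      ∀ p, L p = ∫ z, p (torusProj b z) * Φ z := by
  obtain ⟨M, hM⟩ := hs.exists_bound_of_continuous hΦ
  obtain ⟨C, hC, hle⟩ := exists_map_torusProj_le b hs
  have hq := (quasiMeasurePreserving_torusProj b)
  let L₀ : Lp ℂ 2 (volume : Measure (UnitAddTorus (Fin 2))) →ₗ[ℂ] ℂ :=
    { toFun := fun p => ∫ z, p (torusProj b z) * Φ z
      map_add' := fun p q => by
        rw [← integral_add (integrable_comp_torusProj_mul b p hΦ hs)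
          (integrable_comp_torusProj_mul b q hΦ hs)]
        refine integral_congr_ae ?_
        filter_upwards [hq.ae (Lp.coeFn_add p q)] with z hz
        rw [hz, Pi.add_apply, add_mul]
      map_smul' := fun c p => by
        rw [RingHom.id_apply, smul_eq_mul, ← integral_const_mul]
        refine integral_congr_ae ?_
        filter_upwards [hq.ae (Lp.coeFn_smul c p)] with z hz
        rw [hz, Pi.smul_apply, smul_eq_mul, mul_assoc] }
  -- `M` bounds `Φ` and `C` bounds how heavily its support covers the torus; total mass 1 gives `L¹`
  -- norm at most `L²` norm.
  refine ⟨L₀.mkContinuous (ENNReal.ofReal M * C).toReal fun p => ?_, fun p => rfl⟩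
  have hb : ‖L₀ p‖ₑ ≤ ENNReal.ofReal M * C * ‖p‖ₑ := calc
    ‖L₀ p‖ₑ ≤ ∫⁻ z, ‖p (torusProj b z) * Φ z‖ₑ := enorm_integral_le_lintegral_enorm _
    _ ≤ ∫⁻ z, (tsupport Φ).indicator (fun z => ENNReal.ofReal M * ‖p (torusProj b z)‖ₑ) z := by
      refine lintegral_mono fun z => ?_
      by_cases hz : z ∈ tsupport Φ
      · rw [Set.indicator_of_mem hz, enorm_mul, mul_comm]
        gcongr
        rw [← ofReal_norm]
        exact ENNReal.ofReal_le_ofReal (hM z)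
      · simp [image_eq_zero_of_notMem_tsupport hz]
    _ = ENNReal.ofReal M * ∫⁻ z in tsupport Φ, ‖p (torusProj b z)‖ₑ := by
      rw [lintegral_indicator (isClosed_tsupport Φ).measurableSet,
        lintegral_const_mul' _ _ ENNReal.ofReal_ne_top]
    _ = ENNReal.ofReal M * ∫⁻ t, ‖p t‖ₑ ∂(volume.restrict (tsupport Φ)).map (torusProj b) := by
      rw [lintegral_map (Lp.stronglyMeasurable p).enorm (measurable_torusProj b)]
    _ ≤ ENNReal.ofReal M * (C * ‖p‖ₑ) := by
      gcongr
      refine (lintegral_mono' hle le_rfl).trans ?_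
      rw [lintegral_smul_measure, smul_eq_mul, Lp.enorm_def, ← eLpNorm_one_eq_lintegral_enorm]
      gcongr
      exact eLpNorm_le_eLpNorm_of_exponent_le (by norm_num) (Lp.aestronglyMeasurable p)
    _ = _ := (mul_assoc _ _ _).symm
  have := ENNReal.toReal_mono (by finiteness) hb
  simpa using this

/-- Both sides are continuous in `p` and `q`, so their Fourier series may be paired term by term.
Each term is integration by parts against an exponential, and the hypothesis absorbs the unbounded
symbol into the coefficients of `q`. -/
theorem integral_multiplier_mul_comp_torusProj {σ : ℂ} {k : ℂ × ℂ}
    {p q : Lp ℂ 2 (volume : Measure (UnitAddTorus (Fin 2)))}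
    (h : ∀ n, symbol σ (k + dualVector b n) * mFourierCoeff p n = mFourierCoeff q n)
    {η : ℂ → ℂ} (hη : ContDiff ℝ ∞ η) (hs : HasCompactSupport η) :
    ∫ z, (multiplier k z * p (torusProj b z)) * wirtinger σ η z =
      -∫ z, (multiplier k z * q (torusProj b z)) * η z := by
  have hm := (contDiff_multiplier k).continuous
  obtain ⟨L, hL⟩ := exists_pairing b (Φ := fun z => multiplier k z * wirtinger σ η z)
    (hm.mul (continuous_wirtinger σ hη))
    (hasCompactSupport_wirtinger σ hs).mul_left
  obtain ⟨L', hL'⟩ := exists_pairing b (Φ := fun z => multiplier k z * η z)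
    (hm.mul hη.continuous) hs.mul_left
  have hn : ∀ n, L (mFourierLp 2 n) =
      -(symbol σ (k + dualVector b n) * L' (mFourierLp 2 n)) := by
    intro n
    have hae : ∀ {Φ : ℂ → ℂ}, ∫ z, mFourierLp 2 n (torusProj b z) * (multiplier k z * Φ z) =
        ∫ z, multiplier (k + dualVector b n) z * Φ z := by
      intro Φ
      refine integral_congr_ae ?_
      filter_upwards [(quasiMeasurePreserving_torusProj b).ae (coeFn_mFourierLp 2 n)] with z hz
      rw [hz, mFourier_torusProj, multiplier_add]; ring
    rw [hL, hL', hae, hae, integral_multiplier_mul_wirtinger σ _ hη hs]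
  have h1 := (hasSum_mFourier_series_L2 p).mapL L
  have h2 := ((hasSum_mFourier_series_L2 q).mapL L').neg
  have : L p = -L' q := by
    refine h1.unique ?_
    convert! h2 using 2 with n
    rw [map_smul, map_smul, hn, ← h n, smul_eq_mul, smul_eq_mul]
    ring
  rw [hL, hL'] at this
  convert! this using 1
  · refine integral_congr_ae (.of_forall fun z => ?_)
    simp only; ring
  · congr 1
    refine integral_congr_ae (.of_forall fun z => ?_)
    simp only; ring

/-! ### Complex conjugation of Floquet functions -/

theorem wirtinger_conj (σ : ℂ) {η : ℂ → ℂ} {z : ℂ} (hη : DifferentiableAt ℝ η z) :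
    wirtinger σ (fun z => conj (η z)) z = conj (wirtinger (-conj σ) η z) := by
  have h : HasFDerivAt (fun z => conj (η z)) ((conjCLE : ℂ →L[ℝ] ℂ) ∘L fderiv ℝ η z) z :=
    (conjCLE : ℂ →L[ℝ] ℂ).hasFDerivAt.comp z hη.hasFDerivAt
  simp [wirtinger, h.fderiv, map_ofNat]

theorem locallyIntegrable_conj {f : ℂ → ℂ} (hf : LocallyIntegrable f) :
    LocallyIntegrable fun z => conj (f z) := by
  rw [locallyIntegrable_iff] at hf ⊢
  exact fun K hK => (conjCLE : ℂ →L[ℝ] ℂ).integrable_comp (hf K hK)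

theorem integral_conj_mul_wirtinger {σ : ℂ} {f g : ℂ → ℂ}
    (h : ∀ η : ℂ → ℂ, ContDiff ℝ ∞ η → HasCompactSupport η →
      ∫ z, f z * wirtinger σ η z = -∫ z, g z * η z) {η : ℂ → ℂ} (hη : ContDiff ℝ ∞ η)
    (hs : HasCompactSupport η) :
    ∫ z, conj (f z) * wirtinger (-conj σ) η z = -∫ z, conj (g z) * η z := by
  have hc := h (fun z => conj (η z)) ((conjCLE : ℂ →L[ℝ] ℂ).contDiff.comp hη)
    (hs.comp_left (g := conj) (map_zero _))
  have hc' := congrArg conj hc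
  rw [map_neg, ← integral_conj, ← integral_conj] at hc'
  simpa [wirtinger_conj σ (hη.differentiable (by simp) _)] using hc'

theorem IsWeakDz.conj {f g : ℂ → ℂ} (h : IsWeakDz f g) :
    IsWeakDzbar (fun z => conj (f z)) fun z => conj (g z) := by
  obtain ⟨hf, hg, h⟩ := h
  refine ⟨locallyIntegrable_conj hf, locallyIntegrable_conj hg, fun η hη hs => ?_⟩
  rw [dz_eq_wirtinger] at h
  simpa [dzbar_eq_wirtinger] using integral_conj_mul_wirtinger h hη hs

theorem IsWeakDzbar.neg_conj {f g : ℂ → ℂ} (h : IsWeakDzbar f g) :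
    IsWeakDz (fun z => -conj (f z)) fun z => -conj (g z) := by
  obtain ⟨hf, hg, h⟩ := h
  refine ⟨(locallyIntegrable_conj hf).neg, (locallyIntegrable_conj hg).neg, fun η hη hs => ?_⟩
  rw [dzbar_eq_wirtinger] at h
  have := integral_conj_mul_wirtinger h hη hs
  simp only [neg_mul, integral_neg, neg_inj]
  simpa [dz_eq_wirtinger] using this

theorem IsLocallyL2.conj {f : ℂ → ℂ} (hf : IsLocallyL2 f) : IsLocallyL2 fun z => conj (f z) :=
  fun K hK => (hf K hK).star

theorem conj_multiplier (k : ℂ × ℂ) (γ : ℂ) :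
    conj (multiplier k γ) = multiplier (negConjK k) γ := by
  rw [multiplier, multiplier, ← Complex.exp_conj]
  congr 1
  simp [negConjK, map_ofNat]
  ring

/-- Conjugation turns Floquet functions into Floquet functions if `U = V̄`. -/
theorem IsFloquetFunction.conj {Λ : Submodule ℤ ℂ} {U V : ℂ → ℂ} {k : ℂ × ℂ} {ψ₁ ψ₂ : ℂ → ℂ}
    (h : IsFloquetFunction Λ U V 0 k ψ₁ ψ₂) (hUV : ∀ᵐ z, U z = conj (V z)) :
    IsFloquetFunction Λ U V 0 (negConjK k) (fun z => conj (ψ₂ z)) fun z => -conj (ψ₁ z) where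
  locallyL2_fst := h.locallyL2_snd.conj
  locallyL2_snd K hK := (h.locallyL2_fst.conj K hK).neg
  ne_zero h0 := h.ne_zero (by
    filter_upwards [h0] with z hz
    exact ⟨by simpa using hz.2, by simpa using hz.1⟩)
  solves := by
    obtain ⟨d₁, d₂, h₁, h₂, e₁, e₂⟩ := h.solves
    refine ⟨_, _, h₂.conj, h₁.neg_conj, ?_, ?_⟩
    · filter_upwards [e₂, hUV] with z hz hU
      rw [hU, zero_mul]
      simpa [add_comm] using congrArg conj hz
    · filter_upwards [e₁, hUV] with z hz hU
      rw [hU] at hz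
      have := congrArg conj hz
      simp at this
      linear_combination -this
  quasiperiodic γ hγ := by
    filter_upwards [h.quasiperiodic γ hγ] with z hz
    simp [hz.1, hz.2, conj_multiplier]

theorem negConjK_negConjK (k : ℂ × ℂ) : negConjK (negConjK k) = k := by
  simp [negConjK]

theorem conjK_conjK (k : ℂ × ℂ) : conjK (conjK k) = k := by
  simp [conjK]

/-! ### Floquet functions as solutions of a system on the torus -/

/-- Multiplication by an essentially bounded function, as an operator on `L²` of the torus. -/
def mulOperator (u : Lp ℂ ⊤ (volume : Measure (UnitAddTorus (Fin 2)))) :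
    Lp ℂ 2 (volume : Measure (UnitAddTorus (Fin 2))) →L[ℂ]
      Lp ℂ 2 (volume : Measure (UnitAddTorus (Fin 2))) :=
  (ContinuousLinearMap.mul ℂ ℂ).holderL volume ⊤ 2 2 u

theorem coeFn_mulOperator (u : Lp ℂ ⊤ (volume : Measure (UnitAddTorus (Fin 2))))
    (p : Lp ℂ 2 (volume : Measure (UnitAddTorus (Fin 2)))) :
    ∀ᵐ t, mulOperator u p t = u t * p t :=
  (ContinuousLinearMap.mul ℂ ℂ).coeFn_holder u p

theorem inner_mulOperator_left {u : Lp ℂ ⊤ (volume : Measure (UnitAddTorus (Fin 2)))}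
    (hu : ∀ᵐ t, conj (u t) = u t) (p q : Lp ℂ 2 (volume : Measure (UnitAddTorus (Fin 2)))) :
    inner ℂ (mulOperator u p) q = inner ℂ p (mulOperator u q) := by
  rw [L2.inner_def, L2.inner_def]
  refine integral_congr_ae ?_
  filter_upwards [hu, coeFn_mulOperator u p, coeFn_mulOperator u q] with t ht hp hq
  rw [hp, hq]
  simp [ht]
  ring

theorem inner_mFourierBasis (p : Lp ℂ 2 (volume : Measure (UnitAddTorus (Fin 2))))
    (n : Fin 2 → ℤ) : inner ℂ (mFourierBasis n) p = mFourierCoeff p n := by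
  rw [← mFourierBasis.repr_apply_apply, mFourierBasis_repr]

/-- A periodic potential is the lift of an essentially bounded function on the torus. -/
theorem IsPeriodicPotential.exists_torus {Λ : Submodule ℤ ℂ} [Countable Λ]
    (hb : Submodule.span ℤ (Set.range b) = Λ) {U : ℂ → ℂ} (hU : IsPeriodicPotential Λ U) :
    ∃ u : Lp ℂ ⊤ (volume : Measure (UnitAddTorus (Fin 2))),
      (∀ᵐ z, U z = u (torusProj b z)) ∧ ∀ᵐ t, u t = U (torusSection b t) := by
  have hs := quasiMeasurePreserving_torusSection b
  have hm : MemLp (U ∘ torusSection b) ⊤ volume := by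
    refine ⟨hU.1.1.comp_quasiMeasurePreserving hs, ?_⟩
    have h := hU.1.2
    rw [eLpNorm_exponent_top] at h ⊢
    exact (eLpNormEssSup_le_of_ae_enorm_bound (hs.ae ae_le_eLpNormEssSup)).trans_lt h
  refine ⟨hm.toLp _, ?_, hm.coeFn_toLp⟩
  filter_upwards [(quasiMeasurePreserving_torusProj b).ae hm.coeFn_toLp,
    eq_comp_torusSection_torusProj b hb hU.2] with z h1 h2
  rw [h1, h2, Function.comp_apply]

theorem IsLocallyL2.multiplier_mul {f : ℂ → ℂ} (hf : IsLocallyL2 f) (k : ℂ × ℂ) :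
    IsLocallyL2 fun z => multiplier k z * f z := by
  intro K hK
  have hm := (contDiff_multiplier k).continuous
  obtain ⟨C, hC⟩ := hK.exists_bound_of_continuousOn hm.continuousOn
  refine (hf K hK).of_le_mul (c := C) (hm.aestronglyMeasurable.mul (hf K hK).1) ?_
  refine ae_restrict_of_forall_mem hK.measurableSet fun z hz => ?_
  rw [norm_mul]
  gcongr
  exact hC z hz

theorem isLocallyL2_multiplier_mul_comp_torusProj (k : ℂ × ℂ)
    (p : Lp ℂ 2 (volume : Measure (UnitAddTorus (Fin 2)))) :
    IsLocallyL2 fun z => multiplier k z * p (torusProj b z) :=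
  (isLocallyL2_comp_torusProj b (Lp.memLp p)).multiplier_mul k

/-- A quasi-periodic function is an exponential times the lift of a function on the torus. -/
theorem IsLocallyL2.exists_torus {Λ : Submodule ℤ ℂ} [Countable Λ]
    (hb : Submodule.span ℤ (Set.range b) = Λ) {f : ℂ → ℂ} (hf : IsLocallyL2 f) {k : ℂ × ℂ}
    (hk : ∀ γ ∈ Λ, ∀ᵐ z, f (z + γ) = multiplier k γ * f z) :
    ∃ p : Lp ℂ 2 (volume : Measure (UnitAddTorus (Fin 2))),
      ∀ᵐ z, f z = multiplier k z * p (torusProj b z) := by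
  have hper : IsPeriodic Λ fun z => multiplier (-k) z * f z := by
    -- Dividing by the exponential of `k` cancels the multiplier and leaves a periodic function.
    intro γ hγ
    filter_upwards [hk γ hγ] with z hz
    rw [hz, multiplier_apply_add]
    linear_combination (multiplier (-k) z * f z) * multiplier_neg_mul k γ
  have hm := memLp_comp_torusSection b (hf.multiplier_mul (-k))
  refine ⟨hm.toLp _, ?_⟩
  filter_upwards [(quasiMeasurePreserving_torusProj b).ae hm.coeFn_toLp,
    eq_comp_torusSection_torusProj b hb hper] with z h1 h2
  rw [h1, Function.comp_apply, ← h2]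
  linear_combination -f z * multiplier_neg_mul k z

theorem eq_zero_of_comp_torusProj {p : Lp ℂ 2 (volume : Measure (UnitAddTorus (Fin 2)))}
    (h : ∀ᵐ z, p (torusProj b z) = 0) : p = 0 := by
  rw [Lp.eq_zero_iff_ae_eq_zero]
  filter_upwards [(quasiMeasurePreserving_torusSection b).ae h] with t ht
  simpa only [torusProj_torusSection, Pi.zero_apply] using ht

/-- Quasi-impulses in terms of Fourier coefficients of the periodic parts of Floquet functions. -/
theorem mem_quasiImpulses_iff {Λ : Submodule ℤ ℂ} [Countable Λ]
    (hb : Submodule.span ℤ (Set.range b) = Λ) {U V : ℂ → ℂ}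
    {u v : Lp ℂ ⊤ (volume : Measure (UnitAddTorus (Fin 2)))}
    (hu : ∀ᵐ z, U z = u (torusProj b z)) (hv : ∀ᵐ z, V z = v (torusProj b z)) (k : ℂ × ℂ) :
    k ∈ quasiImpulses Λ U V ↔
      ∃ p₁ p₂ : Lp ℂ 2 (volume : Measure (UnitAddTorus (Fin 2))), ¬ (p₁ = 0 ∧ p₂ = 0) ∧
        (∀ n, symbol 1 (k + dualVector b n) * inner ℂ (mFourierBasis n) p₁ =
          inner ℂ (mFourierBasis n) (mulOperator v p₂)) ∧
        ∀ n, symbol (-1) (k + dualVector b n) * inner ℂ (mFourierBasis n) p₂ =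
          inner ℂ (mFourierBasis n) ((-mulOperator u) p₁) := by
  have hq := quasiMeasurePreserving_torusProj b
  have hint : ∀ p : Lp ℂ 2 (volume : Measure (UnitAddTorus (Fin 2))), Integrable p := fun p =>
    (Lp.memLp p).integrable (by norm_num)
  have hneg : ∀ p, ∀ᵐ t, ((-mulOperator u) p) t = -(u t * p t) := fun p => by
    rw [neg_apply]
    filter_upwards [Lp.coeFn_neg (mulOperator u p), coeFn_mulOperator u p] with t h1 h2
    rw [h1, Pi.neg_apply, h2]
  simp only [inner_mFourierBasis]
  constructor
  · rintro ⟨ψ₁, ψ₂, h⟩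
    obtain ⟨p₁, hp₁⟩ := h.locallyL2_fst.exists_torus b hb fun γ hγ =>
      (h.quasiperiodic γ hγ).mono fun _ hz => hz.1
    obtain ⟨p₂, hp₂⟩ := h.locallyL2_snd.exists_torus b hb fun γ hγ =>
      (h.quasiperiodic γ hγ).mono fun _ hz => hz.2
    obtain ⟨d₁, d₂, ⟨-, -, h₁⟩, ⟨-, -, h₂⟩, e₁, e₂⟩ := h.solves
    rw [dzbar_eq_wirtinger] at h₁
    rw [dz_eq_wirtinger] at h₂
    refine ⟨p₁, p₂, fun h0 => h.ne_zero ?_, fun n => ?_, fun n => ?_⟩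
    · filter_upwards [hp₁, hp₂, hq.ae (Lp.eq_zero_iff_ae_eq_zero.mp h0.1),
        hq.ae (Lp.eq_zero_iff_ae_eq_zero.mp h0.2)] with z h1 h2 h3 h4
      rw [h1, h2, h3, h4]
      simp
    · refine symbol_mul_mFourierCoeff b h₁ (Lp.stronglyMeasurable _) (hint _)
        (Lp.stronglyMeasurable _) (hint _) hp₁ ?_ n
      filter_upwards [e₂, hp₂, hv, hq.ae (coeFn_mulOperator v p₂)] with z h1 h2 h3 h4
      rw [h4, ← h3]
      rw [h2] at h1
      linear_combination -h1
    · refine symbol_mul_mFourierCoeff b h₂ (Lp.stronglyMeasurable _) (hint _)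
        (Lp.stronglyMeasurable _) (hint _) hp₂ ?_ n
      filter_upwards [e₁, hp₁, hu, hq.ae (hneg p₁)] with z h1 h2 h3 h4
      rw [h4, ← h3]
      rw [h2] at h1
      linear_combination h1
  · rintro ⟨p₁, p₂, h0, h₁, h₂⟩
    have hL := isLocallyL2_multiplier_mul_comp_torusProj b k
    refine ⟨fun z => multiplier k z * p₁ (torusProj b z),
      fun z => multiplier k z * p₂ (torusProj b z), hL _, hL _, fun hz => h0 ?_,
      ⟨fun z => multiplier k z * mulOperator v p₂ (torusProj b z),
        fun z => multiplier k z * (-mulOperator u) p₁ (torusProj b z),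
        ⟨(hL _).locallyIntegrable, (hL _).locallyIntegrable, fun η hη hs => ?_⟩,
        ⟨(hL _).locallyIntegrable, (hL _).locallyIntegrable, fun η hη hs => ?_⟩, ?_, ?_⟩, ?_⟩
    · exact ⟨eq_zero_of_comp_torusProj b (hz.mono fun z hz => by
          simpa [multiplier_ne_zero] using hz.1),
        eq_zero_of_comp_torusProj b (hz.mono fun z hz => by
          simpa [multiplier_ne_zero] using hz.2)⟩
    · rw [dzbar_eq_wirtinger]
      exact integral_multiplier_mul_comp_torusProj b h₁ hη hs
    · rw [dz_eq_wirtinger]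
      exact integral_multiplier_mul_comp_torusProj b h₂ hη hs
    · filter_upwards [hu, hq.ae (hneg p₁)] with z h3 h4
      rw [h4, h3]
      ring
    · filter_upwards [hv, hq.ae (coeFn_mulOperator v p₂)] with z h3 h4
      rw [h4, h3]
      ring
    · intro γ hγ
      have hγ0 : torusProj b γ = 0 := by rwa [torusProj_eq_zero_iff, hb]
      refine .of_forall fun z => ?_
      simp only [torusProj_add, hγ0, add_zero, multiplier_apply_add]
      constructor <;> ring

/-! ### Symbols at conjugate quasi-impulses and their growth -/

/-- Dual vectors are real, so conjugation affects only `k`. The outer factor `I` gives the sign and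
the inner one flips `σ`. -/
theorem conj_symbol_add_dualVector (σ : ℝ) (k : ℂ × ℂ) (n : Fin 2 → ℤ) :
    conj (symbol σ (k + dualVector b n)) =
      -symbol ((-σ : ℝ) : ℂ) (conjK k + dualVector b n) := by
  simp [symbol, dualVector, conjK]

theorem re_mul_dualVector_add (n : Fin 2 → ℤ) (z : ℂ) :
    (z.re * (dualVector b n).1 + z.im * (dualVector b n).2 : ℂ) =
      ((∑ i, n i * b.equivFun z i : ℝ) : ℂ) := by
  have hz : b.equivFun z = z.re • b.equivFun 1 + z.im • b.equivFun I := by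
    rw [← map_smul, ← map_smul, ← map_add]; congr 1; simp
  simp only [dualVector, hz, Fin.sum_univ_two]
  simp
  ring

theorem norm_le_norm_add_mul_I {σ : ℝ} (hσ : σ ^ 2 = 1) (x y : ℝ) :
    |x| ≤ ‖(x + σ * I * y : ℂ)‖ ∧ |y| ≤ ‖(x + σ * I * y : ℂ)‖ := by
  have h1 := abs_re_le_norm (x + σ * I * y : ℂ)
  have h2 := abs_im_le_norm (x + σ * I * y : ℂ)
  have h3 : |σ| = 1 := by
    rwa [← sq_eq_sq₀ (abs_nonneg _) zero_le_one, sq_abs, one_pow]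
  simp [abs_mul, h3] at h1 h2
  exact ⟨h1, h2⟩

/-- Pairing the dual vector with the lattice basis recovers `n`, so the dual vector grows at least
linearly in `n`. As it is real and `σ = ±1`, the symbol controls both its coordinates; `k` adds only
a constant. -/
theorem tendsto_norm_symbol {σ : ℝ} (hσ : σ ^ 2 = 1) (k : ℂ × ℂ) :
    Tendsto (fun n => ‖symbol σ (k + dualVector b n)‖) cofinite atTop := by
  have hn : Tendsto (fun n : Fin 2 → ℤ => ‖n‖) cofinite atTop := by
    rw [← cocompact_eq_cofinite]
    exact tendsto_norm_cocompact_atTop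
  -- Both coordinates of `b j` are at most `‖b 0‖ + ‖b 1‖`, whence the factor 2; the summand 1 makes
  -- positivity immediate.
  set M : ℝ := 2 * (‖b 0‖ + ‖b 1‖) + 1 with hM
  have hM0 : 0 < M := by positivity
  have hle : ∀ n : Fin 2 → ℤ,
      ‖n‖ ≤ M * ‖((dualVector b n).1 + σ * I * (dualVector b n).2 : ℂ)‖ := by
    intro n
    obtain ⟨hx, hy⟩ := norm_le_norm_add_mul_I hσ (∑ i, n i * b.equivFun 1 i : ℝ)
      (∑ i, n i * b.equivFun I i : ℝ)
    change _ ≤ M * ‖(((∑ i, n i * b.equivFun 1 i : ℝ) : ℂ) +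
      σ * I * ((∑ i, n i * b.equivFun I i : ℝ) : ℂ))‖
    set x : ℝ := ∑ i, n i * b.equivFun 1 i
    set y : ℝ := ∑ i, n i * b.equivFun I i
    set R := ‖(x + σ * I * y : ℂ)‖
    have hR : 0 ≤ R := norm_nonneg _
    rw [pi_norm_le_iff_of_nonneg (by positivity)]
    intro j
    have hj := re_mul_dualVector_add b n (b j)
    have hj' : (b j).re * x + (b j).im * y = n j := by
      have : (∑ i, n i * b.equivFun (b j) i : ℝ) = n j := by simp
      rw [this] at hj
      change ((b j).re * (x : ℂ) + (b j).im * (y : ℂ)) = _ at hj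
      exact_mod_cast hj
    have hbj : ‖b j‖ ≤ ‖b 0‖ + ‖b 1‖ := by
      fin_cases j <;> simp
    calc ‖n j‖ = |(b j).re * x + (b j).im * y| := by rw [hj']; rfl
      _ ≤ |(b j).re| * |x| + |(b j).im| * |y| := by
        rw [← abs_mul, ← abs_mul]; exact abs_add_le _ _
      _ ≤ (‖b 0‖ + ‖b 1‖) * R + (‖b 0‖ + ‖b 1‖) * R := by
        gcongr
        · exact (abs_re_le_norm _).trans hbj
        · exact (abs_im_le_norm _).trans hbj
      _ ≤ M * R := by rw [hM]; linarith
  refine tendsto_atTop_mono (f := fun n => Real.pi / M * ‖n‖ - ‖symbol σ k‖) (fun n => ?_)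
    (tendsto_atTop_add_const_right _ _ (hn.const_mul_atTop (by positivity)))
  have hsplit : symbol σ (k + dualVector b n) = symbol σ k +
      Real.pi * I * ((dualVector b n).1 + σ * I * (dualVector b n).2) := by
    simp only [symbol, Prod.fst_add, Prod.snd_add]
    ring
  have h1 : Real.pi / M * ‖n‖ ≤
      ‖(Real.pi * I * ((dualVector b n).1 + σ * I * (dualVector b n).2) : ℂ)‖ := by
    rw [norm_mul, norm_mul, norm_I, mul_one, norm_real, Real.norm_of_nonneg Real.pi_pos.le,
      div_mul_eq_mul_div, div_le_iff₀ hM0, mul_assoc]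
    gcongr
    rw [mul_comm]
    exact hle n
  have h2 := norm_sub_le (symbol σ (k + dualVector b n)) (symbol σ k)
  rw [hsplit, add_sub_cancel_left] at h2
  rw [hsplit]
  linarith

/-- The Fredholm alternative for real potentials: conjugate quasi-impulses are quasi-impulses. -/
theorem conjK_mem_quasiImpulses {Λ : Submodule ℤ ℂ} [Countable Λ]
    (hb : Submodule.span ℤ (Set.range b) = Λ) {U V : ℂ → ℂ} (hU : IsPeriodicPotential Λ U)
    (hV : IsPeriodicPotential Λ V) (hUr : ∀ᵐ z, U z = conj (U z))
    (hVr : ∀ᵐ z, V z = conj (V z)) {k : ℂ × ℂ} (hk : k ∈ quasiImpulses Λ U V) :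
    conjK k ∈ quasiImpulses Λ U V := by
  obtain ⟨u, hu, hu'⟩ := hU.exists_torus b hb
  obtain ⟨v, hv, hv'⟩ := hV.exists_torus b hb
  have hs := quasiMeasurePreserving_torusSection b
  have hur : ∀ᵐ t, conj (u t) = u t := by
    filter_upwards [hu', hs.ae hUr] with t h1 h2
    rw [h1, ← h2]
  have hvr : ∀ᵐ t, conj (v t) = v t := by
    filter_upwards [hv', hs.ae hVr] with t h1 h2
    rw [h1, ← h2]
  rw [mem_quasiImpulses_iff b hb hu hv] at hk ⊢
  obtain ⟨y₁, y₂, h0, h₁, h₂⟩ := mFourierBasis.exists_adjoint_system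
    (fun n => symbol 1 (k + dualVector b n)) (fun n => symbol (-1) (k + dualVector b n))
    (by simpa using tendsto_norm_symbol b (σ := 1) (by simp) k)
    (by simpa using tendsto_norm_symbol b (σ := -1) (by simp) k)
    (mulOperator v) (-mulOperator u) hk
  -- The swap undoes the exchange of `∂` and `∂̄`; the sign absorbs the minus from conjugating the
  -- symbols.
  refine ⟨y₂, -y₁, fun h => h0 ⟨by simpa using h.2, h.1⟩, fun n => ?_, fun n => ?_⟩
  · have hc := conj_symbol_add_dualVector b (-1) k n
    have := h₂ n
    rw [inner_mulOperator_left hvr] at this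
    simp at hc
    rw [hc] at this
    rw [map_neg, inner_neg_right, ← this]
    ring
  · have hc := conj_symbol_add_dualVector b 1 k n
    have := h₁ n
    rw [neg_apply, inner_neg_left, inner_mulOperator_left hur] at this
    simp at hc
    rw [hc] at this
    rw [neg_apply, inner_neg_right, inner_neg_right, ← this]
    ring

theorem exists_basis_span_eq (Λ : Submodule ℤ ℂ) [DiscreteTopology Λ] [IsZLattice ℝ Λ] :
    ∃ b : Module.Basis (Fin 2) ℝ ℂ, Submodule.span ℤ (Set.range b) = Λ := by
  have := ZLattice.module_free ℝ Λ
  have := ZLattice.module_finite ℝ Λ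
  have hr : Module.finrank ℤ Λ = 2 := by rw [ZLattice.rank ℝ Λ, Complex.finrank_real_complex]
  exact ⟨(Module.finBasisOfFinrankEq ℤ Λ hr).ofZLatticeBasis ℝ Λ,
    (Module.finBasisOfFinrankEq ℤ Λ hr).ofZLatticeBasis_span ℝ Λ⟩

theorem image_eq_of_involutive {α : Type*} {f : α → α} (hf : Function.Involutive f) {s : Set α}
    (h : ∀ x ∈ s, f x ∈ s) : f '' s = s := by
  refine Set.Subset.antisymm (Set.image_subset_iff.mpr h) fun x hx => ⟨f x, h x hx, hf x⟩

theorem image_floquetSpectrum {Λ : Submodule ℤ ℂ} {U V : ℂ → ℂ} {f : ℂ × ℂ → ℂ × ℂ}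
    {F : (ℂ × ℂ) ⧸ dualLattice Λ → (ℂ × ℂ) ⧸ dualLattice Λ}
    (hF : ∀ k : ℂ × ℂ, F k = (f k : (ℂ × ℂ) ⧸ dualLattice Λ))
    (h : f '' quasiImpulses Λ U V = quasiImpulses Λ U V) :
    F '' floquetSpectrum Λ U V = floquetSpectrum Λ U V := by
  unfold floquetSpectrum
  conv_rhs => rw [← h]
  rw [Set.image_image, Set.image_image]
  exact Set.image_congr fun k _ => hF k

end DiracFloquet

end

theorem proposition3 (Λ : Submodule ℤ ℂ) [DiscreteTopology Λ] [IsZLattice ℝ Λ]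
    (U V : ℂ → ℂ) (hU : DiracFloquet.IsPeriodicPotential Λ U)
    (hV : DiracFloquet.IsPeriodicPotential Λ V) :
    ((∀ᵐ z, U z = conj (V z)) →
      DiracFloquet.negConjK '' DiracFloquet.quasiImpulses Λ U V =
          DiracFloquet.quasiImpulses Λ U V ∧
        DiracFloquet.negConjQ Λ '' DiracFloquet.floquetSpectrum Λ U V =
          DiracFloquet.floquetSpectrum Λ U V) ∧
    ((∀ᵐ z, U z = conj (U z)) → (∀ᵐ z, V z = conj (V z)) →
      DiracFloquet.conjK '' DiracFloquet.quasiImpulses Λ U V =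
          DiracFloquet.quasiImpulses Λ U V ∧
        DiracFloquet.conjQ Λ '' DiracFloquet.floquetSpectrum Λ U V =
          DiracFloquet.floquetSpectrum Λ U V) := by
  constructor
  · intro hUV
    have h := DiracFloquet.image_eq_of_involutive DiracFloquet.negConjK_negConjK
      (s := DiracFloquet.quasiImpulses Λ U V)
      (by rintro k ⟨ψ₁, ψ₂, h⟩; exact ⟨_, _, h.conj hUV⟩)
    exact ⟨h, DiracFloquet.image_floquetSpectrum (fun _ => rfl) h⟩
  · intro hUr hVr
    obtain ⟨b, hb⟩ := DiracFloquet.exists_basis_span_eq Λ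
    have : Countable Λ := countable_of_Lindelof_of_discrete
    have h := DiracFloquet.image_eq_of_involutive DiracFloquet.conjK_conjK
      fun _ => DiracFloquet.conjK_mem_quasiImpulses b hb hU hV hUr hVr
    exact ⟨h, DiracFloquet.image_floquetSpectrum (fun _ => rfl) h⟩
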